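/- Let $d\ge 1$ and $s>0$. Let $\mathbb{T}^d=\mathbb{R}^d/\mathbb{Z}^d$ carry the Euclidean (quotient) distance $|x-y|$, and let $\lambda$ be Lebesgue measure on $\mathbb{T}^d$. A dyadic cube of $\mathbb{T}^d$ is the image $D$ modulo $\mathbb{Z}^d$ of a set $\prod_{i=1}^d[k_i2^{-n},(k_i+1)2^{-n})$ with integers $n\ge 0$ and $k_1,\dots,k_d$; put $|D|=\sqrt d\,2^{-n}$ (the diameter of the cube in $\mathbb{R}^d$). For $t\ge 0$ and $A\subset\mathbb{T}^d$ let $$\mathscr{M}^t_\infty(A)=\inf\Bigl\{\sum_k|D_k|^t : A\subset\bigcup_k D_k,\ D_k \text{ dyadic cubes}\Bigr\},$$ the infimum being over finite or countable covers. Let $\mathscr{G}^s(\mathbb{T}^d)$ be the class of all $G_\delta$-sets $A\subset\mathbb{T}^d$ such that $\mathscr{M}^t_\infty(A\cap D)\ge|D|^t$ for all dyadic cubes $D$ and all $0\le t<s$. Let $E_n$ ($n\in\mathbb{N}$) be open subsets of $\mathbb{T}^d$ and let $\mu_n$ be Borel measures on $\mathbb{T}^d$, absolutely continuous with respect to $\lambda$,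 with $\mu_n(\mathbb{T}^d\setminus E_n)=0$. Suppose that there is a constant $C$ such that $$C^{-1}\le\liminf_{n\to\infty}\frac{\mu_n(B)}{\lambda(B)}\le\limsup_{n\to\infty}\frac{\mu_n(B)}{\lambda(B)}\le C$$ for every ball $B\subset\mathbb{T}^d$ (of positive radius), and $$\iint|x-y|^{-s}\,\mathrm{d}\mu_n(x)\,\mathrm{d}\mu_n(y)<C$$ for all $n$. Then $\limsup_{n\to\infty}E_n=\bigcap_{m}\bigcup_{n\ge m}E_n$ belongs to $\mathscr{G}^s(\mathbb{T}^d)$, and in particular its Hausdorff dimension satisfies $\dim_H\limsup_{n\to\infty}E_n\ge s$. -/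

import Mathlib

open MeasureTheory Filter Topology
open scoped ENNReal

noncomputable section

/-- The torus `𝕋ᵈ = ℝᵈ / ℤᵈ` with its Euclidean (quotient) metric: the `ℓ²`-product of `d` copies
of the circle `ℝ / ℤ`. -/
abbrev Torus (d : ℕ) : Type := PiLp 2 (fun _ : Fin d => UnitAddCircle)

/-- Lebesgue (normalised Haar) measure `λ` on `𝕋ᵈ`: the product of the Lebesgue measures
on the circles. -/
def torusLebesgue (d : ℕ) : Measure (Torus d) :=
  Measure.map (WithLp.toLp 2) (volume : Measure (Fin d → UnitAddCircle))

/-- The dyadic cube of `𝕋ᵈ` of generation `n ≥ 0`: the image modulo `ℤᵈ` of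
`∏ i, [kᵢ 2⁻ⁿ, (kᵢ + 1) 2⁻ⁿ)`. -/
def dyadicCube {d : ℕ} (n : ℕ) (k : Fin d → ℤ) : Set (Torus d) :=
  {x | ∀ i, x i ∈ (fun a : ℝ => (a : UnitAddCircle)) ''
    Set.Ico ((k i : ℝ) * 2⁻¹ ^ n) (((k i : ℝ) + 1) * 2⁻¹ ^ n)}

/-- The diameter `|D| = √d 2⁻ⁿ` of a dyadic cube of side `2⁻ⁿ` in `ℝᵈ`. -/
def dyadicDiam (d n : ℕ) : ℝ≥0∞ := ENNReal.ofReal (Real.sqrt d * 2⁻¹ ^ n)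

/-- The dyadic outer content `𝓜ᵗ_∞`: the infimum of `∑ |D_k|ᵗ` over all covers of `A` by families
of dyadic cubes (there are only countably many dyadic cubes, so every family is countable). -/
def dyadicContent {d : ℕ} (t : ℝ) (A : Set (Torus d)) : ℝ≥0∞ :=
  ⨅ (𝒟 : Set (ℕ × (Fin d → ℤ))) (_ : A ⊆ ⋃ p ∈ 𝒟, dyadicCube p.1 p.2),
    ∑' p : 𝒟, dyadicDiam d p.1.1 ^ t

/-- The class `𝒢ˢ(𝕋ᵈ)` of sets with large intersections. -/
def largeIntersectionClass (d : ℕ) (s : ℝ) : Set (Set (Torus d)) :=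
  {A | IsGδ A ∧ ∀ t : ℝ, 0 ≤ t → t < s → ∀ (n : ℕ) (k : Fin d → ℤ),
    dyadicDiam d n ^ t ≤ dyadicContent t (A ∩ dyadicCube n k)}

/-- The `s`-Riesz energy `∬ |x - y|⁻ˢ dμ(x) dμ(y)`, with `0⁻ˢ = ∞` for `s > 0`. -/
def rieszEnergy {d : ℕ} (s : ℝ) (μ : Measure (Torus d)) : ℝ≥0∞ :=
  ∫⁻ x, ∫⁻ y, edist x y ^ (-s) ∂μ ∂μ

end

/-! Let 0 ≤ t < s, and suppose that dyadic cubes D_k cover D ∩ limsup E_n with ∑ |D_k|^t < |D|^t.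
Put a point mass |D_k|^t inside each D_k and let ν be the sum. Call a cube heavy if its ν-mass is at
least |·|^t: every D_k is heavy, while neither D nor any cube containing D is. A point of D ∩ limsup
E_n lying in no heavy cube is therefore a contradiction. It is found as the intersection of nested
light cubes whose closures lie in E_n for ever larger n (`IsLight.exists_subcube`,
`dyadicDiam_rpow_le_dyadicContent`).

For the inductive step, t < d allows passing to a light cube Q with ν(Q) tiny relative to |Q|^t
(`IsLight.exists_small_mass`). The μ_n-mass of the heavy part of Q is then small
(`measure_inter_heavySet_le_energy`). Indeed, a maximal heavy cube with μ_n-mass at most L|·|^t has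
mass at most L times its ν-mass. Any other must be very fine, by the density bound, and such cubes
carry little mass, by the energy bound. As μ_n(Q) is comparable to λ(Q), some point of Q ∩ E_n
avoids all heavy cubes.

The energy bound itself forces s ≤ d (`le_dimension_of_rieszEnergy_le`), whence t < d. The dimension
bound holds because the dyadic content is at most a constant times Hausdorff measure. -/

/-! ### Dyadic cubes as a nested family of partitions of the torus. -/

/-- The representative in `[0, 1)` of a point of the circle. -/
noncomputable def circleRep (a : UnitAddCircle) : ℝ := (AddCircle.equivIco 1 0 a : ℝ)

lemma circleRep_mem (a : UnitAddCircle) : circleRep a ∈ Set.Ico (0 : ℝ) 1 := by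
  simpa [circleRep] using (AddCircle.equivIco 1 0 a).2

lemma coe_circleRep (a : UnitAddCircle) : ((circleRep a : ℝ) : UnitAddCircle) = a :=
  AddCircle.coe_equivIco

lemma measurable_circleRep : Measurable circleRep :=
  measurable_subtype_coe.comp (AddCircle.measurableEquivIco 1 0).measurable

lemma UnitAddCircle.coe_eq_coe_iff {a b : ℝ} :
    (a : UnitAddCircle) = b ↔ ∃ m : ℤ, b = a + m := by
  rw [← sub_eq_zero, ← AddCircle.coe_sub, AddCircle.coe_eq_zero_iff]
  constructor
  · rintro ⟨n, hn⟩
    refine ⟨-n, ?_⟩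
    simp at hn ⊢
    linarith
  · rintro ⟨m, hm⟩
    refine ⟨-m, ?_⟩
    simp [hm]

lemma UnitAddCircle.exists_lift_norm (x : UnitAddCircle) :
    ∃ r : ℝ, (r : UnitAddCircle) = x ∧ |r| = ‖x‖ := by
  induction x using QuotientAddGroup.induction_on with
  | H z =>
    refine ⟨z - round z, ?_, (UnitAddCircle.norm_eq).symm⟩
    exact UnitAddCircle.coe_eq_coe_iff.2 ⟨round z, by ring⟩

lemma UnitAddCircle.norm_coe_le (x : ℝ) : ‖(x : UnitAddCircle)‖ ≤ |x| := by
  rw [UnitAddCircle.norm_eq]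
  simpa using round_le x 0

section

variable {d : ℕ}

/-- The index of the dyadic cube of generation `n` that contains `x`. -/
noncomputable def dyadicIndex (n : ℕ) (x : Torus d) (i : Fin d) : ℤ := ⌊2 ^ n * circleRep (x i)⌋

/-- The dyadic cube of generation `n` that contains `x`. -/
def dyadicCell (n : ℕ) (x : Torus d) : Set (Torus d) := {y | dyadicIndex n y = dyadicIndex n x}

lemma mem_dyadicCell_self (n : ℕ) (x : Torus d) : x ∈ dyadicCell n x := rfl

lemma dyadicCell_eq_of_mem {n : ℕ} {x y : Torus d} (h : y ∈ dyadicCell n x) :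
    dyadicCell n y = dyadicCell n x := by
  have h' : dyadicIndex n y = dyadicIndex n x := h
  simp [dyadicCell, h']

lemma dyadicCell_anti {m n : ℕ} (h : m ≤ n) (x : Torus d) : dyadicCell n x ⊆ dyadicCell m x := by
  intro y hy
  have key : ∀ (z : Torus d) i, dyadicIndex m z i = dyadicIndex n z i / ((2 ^ (n - m) : ℕ) : ℤ) := by
    intro z i
    rw [dyadicIndex, dyadicIndex, ← Int.floor_div_natCast]
    congr 1
    have : (2 : ℝ) ^ n = 2 ^ m * 2 ^ (n - m) := by rw [← pow_add, Nat.add_sub_cancel' h]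
    rw [this]
    push_cast
    field_simp
  have hy' : dyadicIndex n y = dyadicIndex n x := hy
  funext i
  rw [key, key, hy']

lemma measurable_dyadicIndex (n : ℕ) : Measurable (dyadicIndex (d := d) n) := by
  refine measurable_pi_lambda _ fun i => ?_
  refine Int.measurable_floor.comp (measurable_const.mul (measurable_circleRep.comp ?_))
  exact (PiLp.continuous_apply 2 _ i).measurable

lemma measurableSet_dyadicCell (n : ℕ) (x : Torus d) : MeasurableSet (dyadicCell n x) :=
  measurable_dyadicIndex n (measurableSet_singleton (dyadicIndex n x))

lemma dyadicIndex_mem_Ico (n : ℕ) (x : Torus d) (i : Fin d) :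
    dyadicIndex n x i ∈ Set.Ico (0 : ℤ) (2 ^ n) := by
  obtain ⟨h0, h1⟩ := circleRep_mem (x i)
  have h2 : (0 : ℝ) < 2 ^ n := by positivity
  refine ⟨Int.floor_nonneg.2 (by positivity), Int.floor_lt.2 ?_⟩
  push_cast
  nlinarith

lemma finite_range_dyadicCell (n : ℕ) : (Set.range (dyadicCell (d := d) n)).Finite := by
  have h : (Set.range (dyadicIndex (d := d) n)).Finite := by
    refine (Set.Finite.pi' (ι := Fin d) (t := fun _ => Set.Ico (0 : ℤ) (2 ^ n))
      fun _ => Set.finite_Ico _ _).subset ?_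
    rintro _ ⟨x, rfl⟩ i
    exact dyadicIndex_mem_Ico n x i
  have : Set.range (dyadicCell (d := d) n) ⊆
      (fun k => {y | dyadicIndex n y = k}) '' Set.range (dyadicIndex (d := d) n) := by
    rintro _ ⟨x, rfl⟩
    exact ⟨_, ⟨x, rfl⟩, rfl⟩
  exact (h.image _).subset this

/-- The integer k is arbitrary, so the arc depends only on k modulo 2^n; m records which lift of the
point lies in the interval. -/
lemma mem_arc_iff (n : ℕ) (k : ℤ) (a : UnitAddCircle) :
    a ∈ (fun a : ℝ => (a : UnitAddCircle)) ''
      Set.Ico ((k : ℝ) * 2⁻¹ ^ n) (((k : ℝ) + 1) * 2⁻¹ ^ n) ↔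
    ∃ m : ℤ, ⌊2 ^ n * circleRep a⌋ + m * 2 ^ n = k := by
  have h2 : (0 : ℝ) < 2 ^ n := by positivity
  have hI : ∀ r : ℝ, r ∈ Set.Ico ((k : ℝ) * 2⁻¹ ^ n) (((k : ℝ) + 1) * 2⁻¹ ^ n) ↔
      ⌊2 ^ n * r⌋ = k := by
    intro r
    rw [Int.floor_eq_iff, Set.mem_Ico, inv_pow, ← div_eq_mul_inv, ← div_eq_mul_inv,
      div_le_iff₀ h2, lt_div_iff₀ h2, mul_comm r]
  have hf : ∀ m : ℤ, ⌊2 ^ n * (circleRep a + m)⌋ = ⌊2 ^ n * circleRep a⌋ + m * 2 ^ n := by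
    intro m
    rw [← Int.floor_add_intCast]
    congr 1
    push_cast
    ring
  constructor
  · rintro ⟨r, hr, hra⟩
    rw [hI] at hr
    have : (circleRep a : UnitAddCircle) = (r : UnitAddCircle) := (coe_circleRep a).trans hra.symm
    obtain ⟨m, hm⟩ := UnitAddCircle.coe_eq_coe_iff.1 this
    refine ⟨m, ?_⟩
    rw [← hf, ← hm, hr]
  · rintro ⟨m, hm⟩
    refine ⟨circleRep a + m, (hI _).2 ?_, ?_⟩
    · rw [hf, hm]
    · refine Eq.trans ?_ (coe_circleRep a)
      exact (UnitAddCircle.coe_eq_coe_iff.2 ⟨m, rfl⟩).symm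

/-- Indices of points of the cube are congruent to k modulo 2^n and lie in [0, 2^n), hence coincide.
From here on cubes are handled as cells of points, for which nesting and disjointness are immediate.
-/
lemma dyadicCube_eq_dyadicCell {n : ℕ} {k : Fin d → ℤ} {x : Torus d} (hx : x ∈ dyadicCube n k) :
    dyadicCube n k = dyadicCell n x := by
  have hx' := fun i => (mem_arc_iff n (k i) (x i)).1 (hx i)
  ext y
  constructor
  · intro hy
    have hy' := fun i => (mem_arc_iff n (k i) (y i)).1 (hy i)
    funext i
    obtain ⟨a, ha⟩ := hx' i
    obtain ⟨b, hb⟩ := hy' i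
    have h1 := dyadicIndex_mem_Ico n x i
    have h2 := dyadicIndex_mem_Ico n y i
    have e1 : dyadicIndex n x i % 2 ^ n = k i % 2 ^ n := by
      rw [← ha, Int.add_mul_emod_self_right]; rfl
    have e2 : dyadicIndex n y i % 2 ^ n = k i % 2 ^ n := by
      rw [← hb, Int.add_mul_emod_self_right]; rfl
    rw [Int.emod_eq_of_lt h1.1 h1.2] at e1
    rw [Int.emod_eq_of_lt h2.1 h2.2] at e2
    rw [e1, e2]
  · intro hy i
    refine (mem_arc_iff n (k i) (y i)).2 ?_
    obtain ⟨a, ha⟩ := hx' i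
    refine ⟨a, ?_⟩
    rw [← ha]
    have := congrFun (show dyadicIndex n y = dyadicIndex n x from hy) i
    simp only [dyadicIndex] at this
    rw [this]

lemma dyadicCube_nonempty (n : ℕ) (k : Fin d → ℤ) : (dyadicCube n k).Nonempty := by
  refine ⟨WithLp.toLp 2 fun i => (((k i : ℝ) * 2⁻¹ ^ n : ℝ) : UnitAddCircle), fun i => ?_⟩
  refine ⟨_, ⟨le_rfl, ?_⟩, rfl⟩
  have : (0 : ℝ) < 2⁻¹ ^ n := by positivity
  nlinarith

lemma dyadicCube_dyadicIndex (n : ℕ) (x : Torus d) :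
    dyadicCube n (dyadicIndex n x) = dyadicCell n x :=
  dyadicCube_eq_dyadicCell fun i => (mem_arc_iff n _ (x i)).2 ⟨0, by simp [dyadicIndex]⟩

lemma edist_le_dyadicDiam {n : ℕ} {x y z : Torus d} (hy : y ∈ dyadicCell n x)
    (hz : z ∈ dyadicCell n x) : edist y z ≤ dyadicDiam d n := by
  have hyz : dyadicIndex n y = dyadicIndex n z := Eq.trans hy (Eq.symm hz)
  rw [edist_dist]
  refine ENNReal.ofReal_le_ofReal ?_
  rw [PiLp.dist_eq_of_L2]
  have hc : ∀ i, dist (y i) (z i) ≤ 2⁻¹ ^ n := by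
    intro i
    rw [dist_eq_norm, ← coe_circleRep (y i), ← coe_circleRep (z i), ← AddCircle.coe_sub]
    refine (UnitAddCircle.norm_coe_le _).trans ?_
    have := (Int.abs_sub_lt_one_of_floor_eq_floor (congrFun hyz i)).le
    rw [← mul_sub, abs_mul, abs_of_pos (by positivity : (0 : ℝ) < 2 ^ n)] at this
    rw [inv_pow, ← one_div, le_div_iff₀ (by positivity), mul_comm]
    exact this
  have : ∑ i, dist (y i) (z i) ^ 2 ≤ d * (2⁻¹ ^ n : ℝ) ^ 2 := by
    refine (Finset.sum_le_card_nsmul _ _ ((2⁻¹ ^ n : ℝ) ^ 2) fun i _ => ?_).trans (by simp)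
    exact pow_le_pow_left₀ dist_nonneg (hc i) 2
  refine (Real.sqrt_le_sqrt this).trans ?_
  rw [Real.sqrt_mul (by positivity), Real.sqrt_sq (by positivity)]

lemma dist_apply_le_dist (x y : Torus d) (i : Fin d) : dist (x i) (y i) ≤ dist x y := by
  rw [PiLp.dist_eq_of_L2]
  refine Real.le_sqrt_of_sq_le ?_
  exact Finset.single_le_sum (f := fun i => dist (x i) (y i) ^ 2) (fun _ _ => sq_nonneg _)
    (Finset.mem_univ i)

/-- Every dyadic cube contains a ball of a quarter of its side length. -/
lemma exists_ball_subset_dyadicCell (n : ℕ) (x : Torus d) :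
    ∃ c : Torus d, Metric.ball c (2⁻¹ ^ n / 4) ⊆ dyadicCell n x := by
  rw [← dyadicCube_dyadicIndex]
  set k := dyadicIndex n x
  refine ⟨WithLp.toLp 2 fun i => (((k i + 1 / 2 : ℝ) * 2⁻¹ ^ n : ℝ) : UnitAddCircle), ?_⟩
  intro y hy i
  have h1 := (dist_apply_le_dist y _ i).trans_lt hy
  rw [dist_eq_norm] at h1
  obtain ⟨r, hr, hr'⟩ := UnitAddCircle.exists_lift_norm
    (y i - (((k i + 1 / 2 : ℝ) * 2⁻¹ ^ n : ℝ) : UnitAddCircle))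
  have h2 : |r| < 2⁻¹ ^ n / 4 := by rw [hr']; exact h1
  have h3 := abs_lt.1 h2
  refine ⟨(k i + 1 / 2 : ℝ) * 2⁻¹ ^ n + r, ⟨by linarith, by linarith⟩, ?_⟩
  simp only [AddCircle.coe_add, hr]
  abel

/-! ### Lebesgue measure of cubes and balls. -/

lemma volume_unitAddCircle_univ : (volume : Measure UnitAddCircle) Set.univ = 1 := by
  rw [← (UnitAddCircle.measurePreserving_mk 0).measure_preimage
    MeasurableSet.univ.nullMeasurableSet]
  simp

instance isProbabilityMeasure_volume_unitAddCircle :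
    IsProbabilityMeasure (volume : Measure UnitAddCircle) := ⟨volume_unitAddCircle_univ⟩

instance isProbabilityMeasure_torusLebesgue : IsProbabilityMeasure (torusLebesgue d) :=
  Measure.isProbabilityMeasure_map (WithLp.measurable_toLp 2 _).aemeasurable

lemma volume_setOf_floor_circleRep (n : ℕ) {k : ℤ} (hk : k ∈ Set.Ico (0 : ℤ) (2 ^ n)) :
    (volume : Measure UnitAddCircle) {a | ⌊2 ^ n * circleRep a⌋ = k} = 2⁻¹ ^ n := by
  have hm : MeasurableSet {a : UnitAddCircle | ⌊2 ^ n * circleRep a⌋ = k} :=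
    (Int.measurable_floor.comp (measurable_const.mul measurable_circleRep))
      (measurableSet_singleton k)
  have hI : MeasurePreserving (QuotientAddGroup.mk : ℝ → UnitAddCircle)
      (volume.restrict (Set.Ico (0 : ℝ) 1)) volume := by
    have := UnitAddCircle.measurePreserving_mk 0
    rwa [zero_add, ← restrict_Ico_eq_restrict_Ioc] at this
  rw [← hI.measure_preimage hm.nullMeasurableSet,
    Measure.restrict_apply (hI.measurable hm)]
  have h2 : (0 : ℝ) < 2 ^ n := by positivity
  have : (QuotientAddGroup.mk : ℝ → UnitAddCircle) ⁻¹' {a | ⌊2 ^ n * circleRep a⌋ = k} ∩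
      Set.Ico 0 1 = Set.Ico ((k : ℝ) / 2 ^ n) ((k + 1) / 2 ^ n) := by
    have hr : ∀ r ∈ Set.Ico (0 : ℝ) 1, circleRep (r : UnitAddCircle) = r := by
      intro r hr
      have h0 := circleRep_mem (r : UnitAddCircle)
      refine (AddCircle.coe_eq_coe_iff_of_mem_Ico (p := (1 : ℝ)) (a := 0) ?_ ?_).1
        (coe_circleRep (r : UnitAddCircle))
      · simpa using h0
      · simpa using hr
    ext r
    have hiff : ⌊2 ^ n * r⌋ = k ↔ r ∈ Set.Ico ((k : ℝ) / 2 ^ n) ((k + 1) / 2 ^ n) := by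
      rw [Int.floor_eq_iff, Set.mem_Ico, div_le_iff₀ h2, lt_div_iff₀ h2, mul_comm r]
    constructor
    · rintro ⟨h, h'⟩
      have h : ⌊2 ^ n * circleRep (r : UnitAddCircle)⌋ = k := h
      rw [hr r h'] at h
      exact hiff.1 h
    · intro h
      have h' : r ∈ Set.Ico (0 : ℝ) 1 := by
        have k0 : (0 : ℝ) ≤ k := by exact_mod_cast hk.1
        have k1 : (k : ℝ) + 1 ≤ 2 ^ n := by exact_mod_cast hk.2
        refine ⟨le_trans (by positivity) h.1, h.2.trans_le ?_⟩
        rwa [div_le_one h2]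
      refine ⟨?_, h'⟩
      change ⌊2 ^ n * circleRep (r : UnitAddCircle)⌋ = k
      rw [hr r h']
      exact hiff.2 h
  rw [this, Real.volume_Ico, ← sub_div, add_sub_cancel_left, one_div,
    ENNReal.ofReal_inv_of_pos h2, ENNReal.ofReal_pow (by norm_num), ENNReal.inv_pow]
  simp

lemma torusLebesgue_dyadicCell (n : ℕ) (x : Torus d) :
    torusLebesgue d (dyadicCell n x) = (2⁻¹ ^ n) ^ d := by
  rw [torusLebesgue, Measure.map_apply (WithLp.measurable_toLp 2 _) (measurableSet_dyadicCell n x)]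
  have : WithLp.toLp 2 ⁻¹' dyadicCell n x = Set.univ.pi fun i =>
      {a : UnitAddCircle | ⌊2 ^ n * circleRep a⌋ = dyadicIndex n x i} := by
    ext y
    simp only [Set.mem_preimage, Set.mem_pi, Set.mem_univ, true_imp_iff]
    exact funext_iff
  rw [this, volume_pi, Measure.pi_pi]
  simp [volume_setOf_floor_circleRep n (dyadicIndex_mem_Ico n x _)]

lemma torusLebesgue_ball_le (x : Torus d) (r : ℝ) :
    torusLebesgue d (Metric.ball x r) ≤ ENNReal.ofReal (2 * r) ^ d := by
  rw [torusLebesgue, Measure.map_apply (WithLp.measurable_toLp 2 _) Metric.isOpen_ball.measurableSet]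
  have : WithLp.toLp 2 ⁻¹' Metric.ball x r ⊆ Set.univ.pi fun i => Metric.closedBall (x i) r := by
    intro y hy i _
    exact (dist_apply_le_dist _ x i).trans (le_of_lt hy)
  refine (measure_mono this).trans ?_
  rw [volume_pi, Measure.pi_pi]
  refine (Finset.prod_le_pow_card _ _ (ENNReal.ofReal (2 * r)) fun i _ => ?_).trans (by simp)
  rw [AddCircle.volume_closedBall]
  exact ENNReal.ofReal_le_ofReal (min_le_right _ _)

instance compactSpace_torus : CompactSpace (Torus d) := by
  have : CompactSpace UnitAddCircle := inferInstance
  refine ⟨?_⟩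
  have h := (isCompact_univ (X := Fin d → UnitAddCircle)).image (PiLp.continuous_toLp 2 _)
  rwa [Set.image_univ, (WithLp.toLp_surjective 2).range_eq] at h

/-! ### Powers of cube diameters. -/

lemma dyadicDiam_eq (n : ℕ) : dyadicDiam d n = dyadicDiam d 0 * 2⁻¹ ^ n := by
  rw [dyadicDiam, dyadicDiam, pow_zero, mul_one, ENNReal.ofReal_mul (Real.sqrt_nonneg _),
    ENNReal.ofReal_pow (by norm_num), ENNReal.ofReal_inv_of_pos (by norm_num)]
  simp

lemma dyadicDiam_ne_top (n : ℕ) : dyadicDiam d n ≠ ∞ := ENNReal.ofReal_ne_top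

lemma dyadicDiam_ne_zero (hd : 0 < d) (n : ℕ) : dyadicDiam d n ≠ 0 := by
  have : (0 : ℝ) < d := by exact_mod_cast hd
  exact (ENNReal.ofReal_pos.2 (by positivity)).ne'

lemma antitone_dyadicDiam : Antitone (dyadicDiam d) := by
  intro m n h
  rw [dyadicDiam_eq m, dyadicDiam_eq n]
  exact mul_le_mul' le_rfl (pow_le_pow_of_le_one zero_le (ENNReal.inv_le_one.2 one_le_two) h)

lemma dyadicDiam_rpow (t : ℝ) (ht : 0 ≤ t) (n : ℕ) :
    dyadicDiam d n ^ t = dyadicDiam d 0 ^ t * (2⁻¹ ^ n) ^ t := by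
  rw [dyadicDiam_eq n, ENNReal.mul_rpow_of_nonneg _ _ ht]

lemma dyadicDiam_rpow_ne_top {t : ℝ} (ht : 0 ≤ t) (n : ℕ) : dyadicDiam d n ^ t ≠ ∞ :=
  ENNReal.rpow_ne_top_of_nonneg ht (dyadicDiam_ne_top n)

lemma dyadicDiam_rpow_ne_zero (hd : 0 < d) (t : ℝ) (n : ℕ) : dyadicDiam d n ^ t ≠ 0 :=
  (ENNReal.rpow_pos (pos_iff_ne_zero.2 (dyadicDiam_ne_zero hd n)) (dyadicDiam_ne_top n)).ne'

lemma tendsto_inv_two_pow_rpow {a : ℝ} (ha : 0 < a) :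
    Tendsto (fun n : ℕ => ((2⁻¹ : ℝ≥0∞) ^ n) ^ a) atTop (𝓝 0) := by
  have h : Tendsto (fun n : ℕ => (2⁻¹ : ℝ≥0∞) ^ n) atTop (𝓝 0) :=
    ENNReal.tendsto_pow_atTop_nhds_zero_of_lt_one (by simp)
  have := (ENNReal.continuous_rpow_const (y := a)).tendsto 0 |>.comp h
  rwa [ENNReal.zero_rpow_of_pos ha] at this

lemma tendsto_dyadicDiam_rpow {a : ℝ} (ha : 0 < a) :
    Tendsto (fun n : ℕ => dyadicDiam d n ^ a) atTop (𝓝 0) := by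
  have := ENNReal.Tendsto.const_mul (a := dyadicDiam d 0 ^ a) (tendsto_inv_two_pow_rpow ha)
    (Or.inr (dyadicDiam_rpow_ne_top ha.le 0))
  rw [mul_zero] at this
  exact this.congr fun n => (dyadicDiam_rpow a ha.le n).symm

lemma inv_two_pow_ne_zero (n : ℕ) : (2⁻¹ : ℝ≥0∞) ^ n ≠ 0 := pow_ne_zero _ (by simp)

lemma inv_two_pow_ne_top (n : ℕ) : (2⁻¹ : ℝ≥0∞) ^ n ≠ ∞ := ENNReal.pow_ne_top (by simp)

/-- For t ≤ d the ratio volume / |·|^t does not increase from a cube to a finer one. This turns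
heaviness of a subcube into a bound on its volume by its ν-mass. -/
lemma inv_two_pow_mul_dyadicDiam_rpow_le {g j : ℕ} (h : g ≤ j) {t : ℝ} (ht : 0 ≤ t) (htd : t ≤ d) :
    (2⁻¹ ^ j) ^ d * dyadicDiam d g ^ t ≤ (2⁻¹ ^ g) ^ d * dyadicDiam d j ^ t := by
  obtain ⟨k, rfl⟩ := Nat.exists_eq_add_of_le h
  have hk : ((2⁻¹ : ℝ≥0∞) ^ k) ^ d ≤ (2⁻¹ ^ k) ^ t := by
    rw [← ENNReal.rpow_natCast (_ ^ k) d]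
    exact ENNReal.rpow_le_rpow_of_exponent_ge
      (pow_le_one₀ (zero_le) (ENNReal.inv_le_one.2 one_le_two)) htd
  rw [dyadicDiam_rpow t ht g, dyadicDiam_rpow t ht (g + k), pow_add, mul_pow,
    ENNReal.mul_rpow_of_nonneg _ _ ht]
  calc (2⁻¹ ^ g) ^ d * (2⁻¹ ^ k) ^ d * (dyadicDiam d 0 ^ t * (2⁻¹ ^ g) ^ t)
      ≤ (2⁻¹ ^ g) ^ d * (2⁻¹ ^ k) ^ t * (dyadicDiam d 0 ^ t * (2⁻¹ ^ g) ^ t) := by gcongr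
    _ = _ := by ring

/-! ### Light cubes, heavy cubes and comparison of measures. -/

/-- A set that is a union of dyadic cubes of generation `n`. -/
def IsDyadicUnion (n : ℕ) (S : Set (Torus d)) : Prop := ∀ y ∈ S, dyadicCell n y ⊆ S

lemma isDyadicUnion_dyadicCell {m n : ℕ} (h : m ≤ n) (x : Torus d) :
    IsDyadicUnion n (dyadicCell m x) := by
  intro y hy
  rw [← dyadicCell_eq_of_mem hy]
  exact dyadicCell_anti h y

lemma IsDyadicUnion.measurableSet {n : ℕ} {S : Set (Torus d)} (hS : IsDyadicUnion n S) :
    MeasurableSet S := by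
  have : S = dyadicIndex n ⁻¹' (dyadicIndex n '' S) := by
    refine (Set.subset_preimage_image _ _).antisymm ?_
    rintro z ⟨y, hy, hyz⟩
    exact hS y hy hyz.symm
  rw [this]
  exact measurable_dyadicIndex n (Set.to_countable _).measurableSet

lemma IsDyadicUnion.measure_le {n : ℕ} {S : Set (Torus d)} (hS : IsDyadicUnion n S)
    {α β : Measure (Torus d)} (h : ∀ y ∈ S, α (dyadicCell n y) ≤ β (dyadicCell n y)) :
    α S ≤ β S := by
  have hU : S = ⋃ B ∈ dyadicCell n '' S, B := by
    rw [Set.biUnion_image]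
    exact (Set.iUnion₂_subset hS).antisymm'
      fun y hy => Set.mem_biUnion hy (mem_dyadicCell_self n y)
  have hc : (dyadicCell n '' S).Countable :=
    ((finite_range_dyadicCell n).subset (Set.image_subset_range _ _)).countable
  have hd : (dyadicCell n '' S).PairwiseDisjoint id := by
    rintro _ ⟨x, -, rfl⟩ _ ⟨y, -, rfl⟩ hne
    refine Set.disjoint_left.2 fun z hzx hzy => hne ?_
    rw [← dyadicCell_eq_of_mem hzx, ← dyadicCell_eq_of_mem hzy]
  have hm : ∀ B ∈ dyadicCell n '' S, MeasurableSet (id B) := by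
    rintro _ ⟨x, -, rfl⟩
    exact measurableSet_dyadicCell n x
  have e := fun γ : Measure (Torus d) => measure_biUnion (μ := γ) hc hd hm
  simp only [id] at e
  rw [hU, e, e]
  refine ENNReal.tsum_le_tsum ?_
  rintro ⟨_, x, hx, rfl⟩
  exact h x hx

/-- No dyadic cube of generation at most `n` around `y` has `ν`-mass at least `|·| ^ t`. -/
def IsLight (ν : Measure (Torus d)) (t : ℝ) (n : ℕ) (y : Torus d) : Prop :=
  ∀ i ≤ n, ν (dyadicCell i y) < dyadicDiam d i ^ t

lemma IsLight.congr {ν : Measure (Torus d)} {t : ℝ} {n : ℕ} {x y : Torus d}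
    (hx : IsLight ν t n x) (hy : y ∈ dyadicCell n x) : IsLight ν t n y := by
  intro i hi
  rw [dyadicCell_eq_of_mem (dyadicCell_anti hi x hy)]
  exact hx i hi

/-- The points that lie in some dyadic cube of `ν`-mass at least `|·| ^ t`. -/
def heavySet (ν : Measure (Torus d)) (t : ℝ) : Set (Torus d) :=
  {y | ∃ j, dyadicDiam d j ^ t ≤ ν (dyadicCell j y)}

lemma isLight_of_notMem_heavySet {ν : Measure (Torus d)} {t : ℝ} {y : Torus d}
    (hy : y ∉ heavySet ν t) (n : ℕ) : IsLight ν t n y :=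
  fun i _ => not_le.1 fun h => hy ⟨i, h⟩

/-- A comparison of two measures on all heavy subcubes of a light cube `Q` extends to the union
of the heavy subcubes: split it into the maximal heavy subcubes. -/
lemma measure_inter_heavySet_le {α β ν : Measure (Torus d)} {t : ℝ} {g : ℕ} {x : Torus d}
    (hx : IsLight ν t g x)
    (h : ∀ j, g < j → ∀ y ∈ dyadicCell g x, dyadicDiam d j ^ t ≤ ν (dyadicCell j y) →
      α (dyadicCell j y) ≤ β (dyadicCell j y)) :
    α (dyadicCell g x ∩ heavySet ν t) ≤ β (dyadicCell g x) := by
  classical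
  -- `S j` collects the points whose coarsest heavy cube has generation j, so the `S j` are
  -- disjoint. Lightness of the ambient cube forces j > g.
  let S : ℕ → Set (Torus d) := fun j => {y | y ∈ dyadicCell g x ∧
    dyadicDiam d j ^ t ≤ ν (dyadicCell j y) ∧ ∀ i < j, ν (dyadicCell i y) < dyadicDiam d i ^ t}
  have hgj : ∀ {j y}, y ∈ S j → g < j := by
    intro j y hy
    by_contra hj
    exact absurd ((hx.congr hy.1) j (not_lt.1 hj)) (not_lt.2 hy.2.1)
  have hS : ∀ j, IsDyadicUnion j (S j) := by
    intro j y hy z hz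
    refine ⟨isDyadicUnion_dyadicCell (hgj hy).le x y hy.1 hz, ?_, fun i hi => ?_⟩
    · rw [dyadicCell_eq_of_mem hz]
      exact hy.2.1
    · rw [dyadicCell_eq_of_mem (dyadicCell_anti hi.le y hz)]
      exact hy.2.2 i hi
  have hd : Pairwise (Function.onFun Disjoint S) := by
    intro i j hij
    refine Set.disjoint_left.2 fun y hi hj => ?_
    rcases lt_or_gt_of_ne hij with hlt | hlt
    · exact absurd (hj.2.2 i hlt) (not_lt.2 hi.2.1)
    · exact absurd (hi.2.2 j hlt) (not_lt.2 hj.2.1)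
  have hcov : dyadicCell g x ∩ heavySet ν t ⊆ ⋃ j, S j := by
    rintro y ⟨hy, hex⟩
    refine Set.mem_iUnion.2 ⟨Nat.find hex, hy, Nat.find_spec hex, fun i hi => ?_⟩
    exact not_le.1 (Nat.find_min hex hi)
  calc α (dyadicCell g x ∩ heavySet ν t) ≤ α (⋃ j, S j) := measure_mono hcov
    _ ≤ ∑' j, α (S j) := measure_iUnion_le _
    _ ≤ ∑' j, β (S j) := ENNReal.tsum_le_tsum fun j =>
        (hS j).measure_le fun y hy => h j (hgj hy) y hy.1 hy.2.1
    _ = β (⋃ j, S j) := (measure_iUnion hd fun j => (hS j).measurableSet).symm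
    _ ≤ β (dyadicCell g x) := measure_mono (Set.iUnion_subset fun j y hy => hy.1)

/-- A light cube has a light subcube of arbitrarily small relative `ν`-mass. -/
lemma IsLight.exists_small_mass (hd : 0 < d) {ν : Measure (Torus d)} [IsFiniteMeasure ν] {t : ℝ}
    (ht : 0 ≤ t) (htd : t < d) {g : ℕ} {x : Torus d} (hx : IsLight ν t g x) {ε : ℝ≥0∞}
    (hε : ε ≠ 0) :
    ∃ j ≥ g, ∃ y ∈ dyadicCell g x, IsLight ν t j y ∧
      ν (dyadicCell j y) ≤ ε * dyadicDiam d j ^ t := by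
  by_contra! hcon
  set G := dyadicCell g x \ heavySet ν t with hG
  -- With Q the given cube, |Q|^t λ is compared with λ(Q) ν on heavy subcubes; the strict inequality
  -- ν(Q) < |Q|^t then leaves Lebesgue mass outside the heavy set.
  have hheavy : torusLebesgue d (dyadicCell g x ∩ heavySet ν t) <
      torusLebesgue d (dyadicCell g x) := by
    have h1 := measure_inter_heavySet_le (α := (dyadicDiam d g ^ t) • torusLebesgue d)
      (β := ((2⁻¹ : ℝ≥0∞) ^ g) ^ d • ν) hx fun j hj y _ hjy => by
        simp only [Measure.smul_apply, smul_eq_mul, torusLebesgue_dyadicCell]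
        rw [mul_comm]
        exact (inv_two_pow_mul_dyadicDiam_rpow_le hj.le ht htd.le).trans (by gcongr)
    simp only [Measure.smul_apply, smul_eq_mul] at h1
    have h2 : ((2⁻¹ : ℝ≥0∞) ^ g) ^ d * ν (dyadicCell g x) <
        ((2⁻¹ : ℝ≥0∞) ^ g) ^ d * dyadicDiam d g ^ t :=
      (ENNReal.mul_lt_mul_iff_right (pow_ne_zero _ (inv_two_pow_ne_zero g))
        (ENNReal.pow_ne_top (inv_two_pow_ne_top g))).2 (hx g le_rfl)
    have h3 := h1.trans_lt h2
    rw [mul_comm (_ ^ d), ENNReal.mul_lt_mul_iff_right (dyadicDiam_rpow_ne_zero hd t g)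
      (dyadicDiam_rpow_ne_top ht g)] at h3
    rwa [torusLebesgue_dyadicCell]
  have hGpos : torusLebesgue d G ≠ 0 := by
    intro h0
    have := measure_le_inter_add_sdiff (torusLebesgue d) (dyadicCell g x) (heavySet ν t)
    rw [← hG, h0, add_zero] at this
    exact absurd hheavy (not_lt.2 this)
  -- By `hcon` every generation-j cube meeting `G` has ν-mass above ε|·|^t. About λ(G) 2^(jd) such
  -- cubes would push the total mass of ν to order 2^(j(d-t)), which is unbounded.
  have hbound : ∀ j ≥ g, torusLebesgue d G * ε * dyadicDiam d 0 ^ t ≤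
      ((2⁻¹ : ℝ≥0∞) ^ j) ^ (d - t) * ν Set.univ := by
    intro j hj
    let S : Set (Torus d) := {y | ε * dyadicDiam d j ^ t ≤ ν (dyadicCell j y)}
    have hS : IsDyadicUnion j S := by
      intro y hy z hz
      change ε * dyadicDiam d j ^ t ≤ ν (dyadicCell j z)
      rw [dyadicCell_eq_of_mem hz]
      exact hy
    have h1 := hS.measure_le (α := (ε * dyadicDiam d j ^ t) • torusLebesgue d)
      (β := ((2⁻¹ : ℝ≥0∞) ^ j) ^ d • ν) fun y hy => by
        simp only [Measure.smul_apply, smul_eq_mul, torusLebesgue_dyadicCell]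
        rw [mul_comm]
        gcongr
        exact hy
    simp only [Measure.smul_apply, smul_eq_mul] at h1
    have h2 : torusLebesgue d G ≤ torusLebesgue d S :=
      measure_mono fun y hy => (hcon j hj y hy.1 (isLight_of_notMem_heavySet hy.2 j)).le
    have hu := inv_two_pow_ne_zero j
    have hu' := inv_two_pow_ne_top j
    have hut : ((2⁻¹ : ℝ≥0∞) ^ j) ^ t ≠ 0 := (ENNReal.rpow_pos (pos_iff_ne_zero.2 hu) hu').ne'
    have hut' : ((2⁻¹ : ℝ≥0∞) ^ j) ^ t ≠ ∞ := ENNReal.rpow_ne_top_of_nonneg ht hu'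
    rw [← ENNReal.mul_le_mul_iff_right hut hut']
    calc ((2⁻¹ : ℝ≥0∞) ^ j) ^ t * (torusLebesgue d G * ε * dyadicDiam d 0 ^ t)
        = ε * dyadicDiam d j ^ t * torusLebesgue d G := by rw [dyadicDiam_rpow t ht j]; ring
      _ ≤ ε * dyadicDiam d j ^ t * torusLebesgue d S := by gcongr
      _ ≤ ((2⁻¹ : ℝ≥0∞) ^ j) ^ d * ν S := h1
      _ ≤ ((2⁻¹ : ℝ≥0∞) ^ j) ^ d * ν Set.univ := by gcongr; exact Set.subset_univ _
      _ = _ := by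
        rw [← mul_assoc, ← ENNReal.rpow_add _ _ hu hu', add_sub_cancel, ENNReal.rpow_natCast]
  have hlim : Tendsto (fun j : ℕ => ((2⁻¹ : ℝ≥0∞) ^ j) ^ (d - t) * ν Set.univ) atTop (𝓝 0) := by
    have := ENNReal.Tendsto.mul_const (b := ν Set.univ)
      (tendsto_inv_two_pow_rpow (sub_pos.2 htd)) (Or.inr (measure_ne_top _ _))
    rwa [zero_mul] at this
  have h0 : torusLebesgue d G * ε * dyadicDiam d 0 ^ t ≤ 0 :=
    ge_of_tendsto hlim (eventually_atTop.2 ⟨g, hbound⟩)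
  exact mul_ne_zero (mul_ne_zero hGpos hε) (dyadicDiam_rpow_ne_zero hd t 0) (le_zero_iff.1 h0)

/-- A measure with small dyadic density down to generation `J` and finite energy gives little mass
to the heavy part of a light cube. -/
lemma measure_inter_heavySet_le_energy (hd : 0 < d) {μ ν : Measure (Torus d)} {s t : ℝ}
    (ht : 0 ≤ t) (hts : t < s) {g J : ℕ} {x : Torus d} (hx : IsLight ν t g x) {L : ℝ≥0∞}
    (hL : L ≠ 0) (hL' : L ≠ ∞)
    (hJ : ∀ j, g < j → j ≤ J → ∀ y, μ (dyadicCell j y) ≤ L * dyadicDiam d j ^ t) :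
    μ (dyadicCell g x ∩ heavySet ν t) ≤
      L * ν (dyadicCell g x) + L⁻¹ * dyadicDiam d J ^ (s - t) * rieszEnergy s μ := by
  set a := L⁻¹ * dyadicDiam d J ^ (s - t) with ha
  have ha' : a ≠ ∞ := ENNReal.mul_ne_top (ENNReal.inv_ne_top.2 hL)
    (dyadicDiam_rpow_ne_top (sub_nonneg.2 hts.le) J)
  -- `f` is the Riesz potential of μ, scaled so that it is at least 1 on every heavy subcube
  -- violating μ ≤ L|·|^t; on those, μ ≤ f μ.
  let f : Torus d → ℝ≥0∞ := fun y => a * ∫⁻ z, edist y z ^ (-s) ∂μ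
  have key := measure_inter_heavySet_le (α := μ) (β := L • ν + μ.withDensity f) hx
    fun j hj y _ hjy => by
      have hm := measurableSet_dyadicCell j y
      rw [Measure.add_apply, Measure.smul_apply, smul_eq_mul, withDensity_apply _ hm]
      -- If the bound holds, heaviness gives μ ≤ Lν on the cube. Otherwise j > J, and at each point
      -- of the cube the potential is at least |·|^(-s) μ(cube) > L|·|^(t-s).
      by_cases hc : μ (dyadicCell j y) ≤ L * dyadicDiam d j ^ t
      · exact le_add_right (hc.trans (by gcongr))
      refine le_add_left ?_
      have hjJ : J < j := by
        by_contra h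
        exact hc (hJ j hj (not_lt.1 h) y)
      have hf : ∀ w ∈ dyadicCell j y, 1 ≤ f w := by
        intro w hw
        have hb : dyadicDiam d j ^ (s - t) ≠ 0 := dyadicDiam_rpow_ne_zero hd _ j
        have hb' : dyadicDiam d j ^ (s - t) ≠ ∞ :=
          dyadicDiam_rpow_ne_top (sub_nonneg.2 hts.le) j
        calc (1 : ℝ≥0∞) = dyadicDiam d j ^ (s - t) * (dyadicDiam d j ^ (s - t))⁻¹ :=
              (ENNReal.mul_inv_cancel hb hb').symm
          _ ≤ dyadicDiam d J ^ (s - t) * (dyadicDiam d j ^ (s - t))⁻¹ := by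
              gcongr ?_ * _
              exact ENNReal.rpow_le_rpow (antitone_dyadicDiam hjJ.le) (sub_nonneg.2 hts.le)
          _ = (L⁻¹ * L) * (dyadicDiam d J ^ (s - t) * (dyadicDiam d j ^ (s - t))⁻¹) := by
              rw [ENNReal.inv_mul_cancel hL hL', one_mul]
          _ = a * (dyadicDiam d j ^ (-s) * (L * dyadicDiam d j ^ t)) := by
              rw [← ENNReal.rpow_neg, neg_sub, sub_eq_neg_add t s,
                ENNReal.rpow_add _ _ (dyadicDiam_ne_zero hd j) (dyadicDiam_ne_top j), ha]
              ring
          _ ≤ a * (dyadicDiam d j ^ (-s) * μ (dyadicCell j y)) := by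
              gcongr
              exact (not_le.1 hc).le
          _ = a * ∫⁻ _ in dyadicCell j y, dyadicDiam d j ^ (-s) ∂μ := by
              rw [setLIntegral_const]
          _ ≤ a * ∫⁻ z in dyadicCell j y, edist w z ^ (-s) ∂μ := by
              gcongr a * ?_
              refine setLIntegral_mono' hm fun z hz => ?_
              rw [ENNReal.rpow_neg, ENNReal.rpow_neg]
              exact ENNReal.inv_le_inv.2
                (ENNReal.rpow_le_rpow (edist_le_dyadicDiam hw hz) (by linarith))
          _ ≤ f w := by
              exact mul_le_mul_right (setLIntegral_le_lintegral _ _) _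
      calc μ (dyadicCell j y) = ∫⁻ _ in dyadicCell j y, 1 ∂μ := by simp
        _ ≤ _ := setLIntegral_mono' hm hf
  refine key.trans ?_
  rw [Measure.add_apply, Measure.smul_apply, smul_eq_mul,
    withDensity_apply _ (measurableSet_dyadicCell g x), rieszEnergy, ← lintegral_const_mul' _ _ ha']
  exact add_le_add_right (setLIntegral_le_lintegral _ _) _

/-! ### From densities on balls to densities on dyadic cubes. -/

lemma dyadicCell_subset_closedBall (n : ℕ) (x : Torus d) :
    dyadicCell n x ⊆ Metric.closedBall x (Real.sqrt d * 2⁻¹ ^ n) := by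
  intro y hy
  have h := edist_le_dyadicDiam hy (mem_dyadicCell_self n x)
  rw [dyadicDiam, edist_dist] at h
  exact (ENNReal.ofReal_le_ofReal_iff (by positivity)).1 h

lemma exists_dyadicCell_subset_ball (d : ℕ) {r : ℝ} (hr : 0 < r) :
    ∃ m, ∀ (j : ℕ) (x : Torus d), dyadicCell (j + m) x ⊆ Metric.ball x (r * 2⁻¹ ^ j) := by
  have hlim : Tendsto (fun m : ℕ => Real.sqrt d * (2⁻¹ : ℝ) ^ m) atTop (𝓝 0) := by
    have := (tendsto_pow_atTop_nhds_zero_of_lt_one (r := (2⁻¹ : ℝ)) (by norm_num)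
      (by norm_num)).const_mul (Real.sqrt d)
    rwa [mul_zero] at this
  obtain ⟨m, hm⟩ := (hlim.eventually_lt_const hr).exists
  refine ⟨m, fun j x => (dyadicCell_subset_closedBall _ x).trans
    (Metric.closedBall_subset_ball ?_)⟩
  rw [pow_add, mul_comm (_ ^ j), ← mul_assoc]
  exact mul_lt_mul_of_pos_right hm (by positivity)

lemma torusLebesgue_ball_pos (x : Torus d) {r : ℝ} (hr : 0 < r) :
    0 < torusLebesgue d (Metric.ball x r) := by
  obtain ⟨m, hm⟩ := exists_dyadicCell_subset_ball d hr
  have h := hm 0 x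
  rw [pow_zero, mul_one] at h
  refine lt_of_lt_of_le ?_ (measure_mono h)
  rw [torusLebesgue_dyadicCell]
  exact pos_iff_ne_zero.2 (pow_ne_zero _ (inv_two_pow_ne_zero _))

/-- Each cube lies in a ball of comparable volume. Uniformity in y comes from there being finitely
many cubes per generation; 2C leaves room to pass from the limsup to large n. -/
lemma exists_eventually_measure_dyadicCell_le {μ : ℕ → Measure (Torus d)} {C : ℝ} (hC : 0 < C)
    (hupper : ∀ (x : Torus d) (r : ℝ), 0 < r →
      limsup (fun n => μ n (Metric.ball x r) / torusLebesgue d (Metric.ball x r)) atTop ≤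
        ENNReal.ofReal C) :
    ∃ K : ℝ≥0∞, K ≠ 0 ∧ K ≠ ∞ ∧ ∀ j, ∀ᶠ n in atTop, ∀ y,
      μ n (dyadicCell j y) ≤ K * (2⁻¹ ^ j) ^ d := by
  have hR : 0 < Real.sqrt d + 1 := by positivity
  refine ⟨ENNReal.ofReal (2 * C) * ENNReal.ofReal (2 * (Real.sqrt d + 1)) ^ d, ?_, ?_, ?_⟩
  · exact mul_ne_zero (ENNReal.ofReal_pos.2 (by positivity)).ne'
      (pow_ne_zero _ (ENNReal.ofReal_pos.2 (by positivity)).ne')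
  · exact ENNReal.mul_ne_top ENNReal.ofReal_ne_top (ENNReal.pow_ne_top ENNReal.ofReal_ne_top)
  intro j
  suffices h : ∀ᶠ n in atTop, ∀ S ∈ Set.range (dyadicCell (d := d) j), μ n S ≤
      ENNReal.ofReal (2 * C) * ENNReal.ofReal (2 * (Real.sqrt d + 1)) ^ d * (2⁻¹ ^ j) ^ d by
    filter_upwards [h] with n hn y using hn _ ⟨y, rfl⟩
  refine (eventually_all_finite (finite_range_dyadicCell j)).2 ?_
  rintro _ ⟨x, rfl⟩
  have hr : 0 < (Real.sqrt d + 1) * 2⁻¹ ^ j := by positivity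
  have hlt : limsup (fun n => μ n (Metric.ball x ((Real.sqrt d + 1) * 2⁻¹ ^ j)) /
      torusLebesgue d (Metric.ball x ((Real.sqrt d + 1) * 2⁻¹ ^ j))) atTop <
        ENNReal.ofReal (2 * C) :=
    (hupper x _ hr).trans_lt ((ENNReal.ofReal_lt_ofReal_iff (by positivity)).2 (by linarith))
  filter_upwards [eventually_lt_of_limsup_lt hlt] with n hn
  have hn' := (ENNReal.div_le_iff_le_mul (Or.inl (torusLebesgue_ball_pos x hr).ne')
    (Or.inl (measure_ne_top _ _))).1 hn.le
  calc μ n (dyadicCell j x) ≤ μ n (Metric.ball x ((Real.sqrt d + 1) * 2⁻¹ ^ j)) := by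
        refine measure_mono ((dyadicCell_subset_closedBall j x).trans
          (Metric.closedBall_subset_ball ?_))
        have : (0 : ℝ) < 2⁻¹ ^ j := by positivity
        linarith
    _ ≤ _ := hn'
    _ ≤ ENNReal.ofReal (2 * C) * ENNReal.ofReal (2 * ((Real.sqrt d + 1) * 2⁻¹ ^ j)) ^ d := by
        gcongr
        exact torusLebesgue_ball_le x _
    _ = _ := by
        rw [← mul_assoc 2, ENNReal.ofReal_mul (p := 2 * (Real.sqrt d + 1)) (by positivity),
          mul_pow, ← mul_assoc, ENNReal.ofReal_pow (by norm_num),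
          ENNReal.ofReal_inv_of_pos (by norm_num)]
        simp

/-- The lower bound is placed on an open ball `U` inside the cube because cubes are half-open: a
point of `U` ∩ E_n has a whole neighbourhood in it. -/
lemma exists_eventually_le_measure {μ : ℕ → Measure (Torus d)} {C : ℝ} (hC : 0 < C)
    (hlower : ∀ (x : Torus d) (r : ℝ), 0 < r → ENNReal.ofReal C⁻¹ ≤
      liminf (fun n => μ n (Metric.ball x r) / torusLebesgue d (Metric.ball x r)) atTop) :
    ∃ c : ℝ≥0∞, c ≠ 0 ∧ c ≠ ∞ ∧ ∀ (j : ℕ) (x : Torus d), ∃ U ⊆ dyadicCell j x, IsOpen U ∧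
      ∀ᶠ n in atTop, c * (2⁻¹ ^ j) ^ d ≤ μ n U := by
  obtain ⟨m, hm⟩ := exists_dyadicCell_subset_ball d (r := 1 / 4) (by norm_num)
  have hC' : 0 < C⁻¹ := inv_pos.2 hC
  refine ⟨ENNReal.ofReal (C⁻¹ / 2) * (2⁻¹ ^ m) ^ d, ?_, ?_, fun j x => ?_⟩
  · exact mul_ne_zero (ENNReal.ofReal_pos.2 (by positivity)).ne'
      (pow_ne_zero _ (inv_two_pow_ne_zero _))
  · exact ENNReal.mul_ne_top ENNReal.ofReal_ne_top (ENNReal.pow_ne_top (inv_two_pow_ne_top _))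
  obtain ⟨z, hz⟩ := exists_ball_subset_dyadicCell j x
  refine ⟨_, hz, Metric.isOpen_ball, ?_⟩
  have hr : (0 : ℝ) < 2⁻¹ ^ j / 4 := by positivity
  have hlt : ENNReal.ofReal (C⁻¹ / 2) < liminf (fun n => μ n (Metric.ball z (2⁻¹ ^ j / 4)) /
      torusLebesgue d (Metric.ball z (2⁻¹ ^ j / 4))) atTop :=
    ((ENNReal.ofReal_lt_ofReal_iff hC').2 (by linarith)).trans_le (hlower z _ hr)
  filter_upwards [eventually_lt_of_lt_liminf hlt] with n hn
  have hn' := (ENNReal.le_div_iff_mul_le (Or.inl (torusLebesgue_ball_pos z hr).ne')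
    (Or.inl (measure_ne_top _ _))).1 hn.le
  refine le_trans ?_ hn'
  rw [mul_assoc, ← mul_pow, ← pow_add, add_comm, ← torusLebesgue_dyadicCell (j + m) z]
  gcongr
  convert hm j z using 2
  ring

/-- Finite energies of measures comparable to Lebesgue measure force `s ≤ d`. -/
lemma le_dimension_of_rieszEnergy_le {μ : ℕ → Measure (Torus d)} {s : ℝ} (hs : 0 < s)
    {c M : ℝ≥0∞} (hc : c ≠ 0) (hM : M ≠ ∞)
    (hlow : ∀ (j : ℕ) (x : Torus d), ∃ U ⊆ dyadicCell j x, IsOpen U ∧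
      ∀ᶠ n in atTop, c * (2⁻¹ ^ j) ^ d ≤ μ n U)
    (henergy : ∀ n, rieszEnergy s (μ n) ≤ M) : s ≤ d := by
  by_contra! hds
  have hcell : ∀ j, ∀ᶠ n in atTop, ∀ y, c * (2⁻¹ ^ j) ^ d ≤ μ n (dyadicCell j y) := by
    intro j
    suffices h : ∀ᶠ n in atTop, ∀ S ∈ Set.range (dyadicCell (d := d) j),
        c * (2⁻¹ ^ j) ^ d ≤ μ n S by
      filter_upwards [h] with n hn y using hn _ ⟨y, rfl⟩
    refine (eventually_all_finite (finite_range_dyadicCell j)).2 ?_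
    rintro _ ⟨x, rfl⟩
    obtain ⟨U, hU, -, h⟩ := hlow j x
    filter_upwards [h] with n hn using hn.trans (measure_mono hU)
  -- Restricting the inner energy integral to the generation-j cube of y bounds the energy below by
  -- |·|^(-s) c 2^(-jd) times the total mass, itself at least c. For s > d this blows up.
  have hbound : ∀ j, c * c ≤ M * dyadicDiam d 0 ^ s * (2⁻¹ ^ j) ^ (s - d) := by
    intro j
    obtain ⟨n, hn, hn0⟩ := ((hcell j).and (hcell 0)).exists
    have huniv : c ≤ μ n Set.univ := by
      have := (hn0 (WithLp.toLp 2 0)).trans (measure_mono (Set.subset_univ _))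
      simpa using this
    have h1 : c * (2⁻¹ ^ j) ^ d * c / dyadicDiam d j ^ s ≤ M := by
      refine le_trans ?_ (henergy n)
      calc c * (2⁻¹ ^ j) ^ d * c / dyadicDiam d j ^ s
          = dyadicDiam d j ^ (-s) * (c * (2⁻¹ ^ j) ^ d) * c := by
            rw [ENNReal.rpow_neg, div_eq_mul_inv]; ring
        _ ≤ dyadicDiam d j ^ (-s) * (c * (2⁻¹ ^ j) ^ d) * μ n Set.univ := by gcongr
        _ = ∫⁻ _, dyadicDiam d j ^ (-s) * (c * (2⁻¹ ^ j) ^ d) ∂μ n := (lintegral_const _).symm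
        _ ≤ rieszEnergy s (μ n) := lintegral_mono fun y => ?_
      calc dyadicDiam d j ^ (-s) * (c * (2⁻¹ ^ j) ^ d)
          ≤ dyadicDiam d j ^ (-s) * μ n (dyadicCell j y) := by gcongr; exact hn y
        _ = ∫⁻ _ in dyadicCell j y, dyadicDiam d j ^ (-s) ∂μ n := (setLIntegral_const _ _).symm
        _ ≤ ∫⁻ z in dyadicCell j y, edist y z ^ (-s) ∂μ n := by
            refine setLIntegral_mono' (measurableSet_dyadicCell j y) fun z hz => ?_
            rw [ENNReal.rpow_neg, ENNReal.rpow_neg]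
            exact ENNReal.inv_le_inv.2 (ENNReal.rpow_le_rpow
              (edist_le_dyadicDiam (mem_dyadicCell_self j y) hz) hs.le)
        _ ≤ _ := setLIntegral_le_lintegral _ _
    have h2 := (ENNReal.div_le_iff_le_mul (Or.inr hM)
      (Or.inl (dyadicDiam_rpow_ne_top hs.le j))).1 h1
    have hu := pow_ne_zero d (inv_two_pow_ne_zero j)
    have hu' := ENNReal.pow_ne_top (n := d) (inv_two_pow_ne_top j)
    rw [← ENNReal.mul_le_mul_iff_right hu hu']
    calc ((2⁻¹ : ℝ≥0∞) ^ j) ^ d * (c * c) = c * (2⁻¹ ^ j) ^ d * c := by ring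
      _ ≤ M * dyadicDiam d j ^ s := h2
      _ = M * dyadicDiam d 0 ^ s * ((2⁻¹ ^ j) ^ ((d : ℝ) + (s - d))) := by
          rw [dyadicDiam_rpow s hs.le j, add_sub_cancel, mul_assoc]
      _ = _ := by
          rw [ENNReal.rpow_add _ _ (inv_two_pow_ne_zero j) (inv_two_pow_ne_top j),
            ENNReal.rpow_natCast]
          ring
  have hlim : Tendsto (fun j : ℕ => M * dyadicDiam d 0 ^ s * ((2⁻¹ : ℝ≥0∞) ^ j) ^ (s - d)) atTop
      (𝓝 0) := by
    have := ENNReal.Tendsto.const_mul (a := M * dyadicDiam d 0 ^ s)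
      (tendsto_inv_two_pow_rpow (sub_pos.2 hds))
      (Or.inr (ENNReal.mul_ne_top hM (dyadicDiam_rpow_ne_top hs.le 0)))
    rwa [mul_zero] at this
  exact mul_ne_zero hc hc (le_zero_iff.1 (ge_of_tendsto' hlim hbound))

/-! ### The nested construction and the content bound. -/

/-- Every light cube contains, for arbitrarily late `n`, a light cube compactly inside `E n`. -/
lemma IsLight.exists_subcube (hd : 0 < d) {s t : ℝ} (ht : 0 ≤ t) (hts : t < s) (htd : t < d)
    {E : ℕ → Set (Torus d)} (hE : ∀ n, IsOpen (E n))
    {μ : ℕ → Measure (Torus d)} (hμE : ∀ n, μ n (E n)ᶜ = 0)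
    {c K M : ℝ≥0∞} (hc : c ≠ 0) (hc' : c ≠ ∞) (hK : K ≠ 0) (hK' : K ≠ ∞) (hM : M ≠ ∞)
    (hup : ∀ j, ∀ᶠ n in atTop, ∀ y, μ n (dyadicCell j y) ≤ K * (2⁻¹ ^ j) ^ d)
    (hlow : ∀ (j : ℕ) (x : Torus d), ∃ U ⊆ dyadicCell j x, IsOpen U ∧
      ∀ᶠ n in atTop, c * (2⁻¹ ^ j) ^ d ≤ μ n U)
    (henergy : ∀ n, rieszEnergy s (μ n) ≤ M)
    {ν : Measure (Torus d)} [IsFiniteMeasure ν] {g : ℕ} {x : Torus d} (hx : IsLight ν t g x)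
    (N : ℕ) :
    ∃ n ≥ N, ∃ j > g, ∃ y, IsLight ν t j y ∧ closure (dyadicCell j y) ⊆ dyadicCell g x ∩ E n := by
  -- This ε makes Lν(Q) at most a quarter of the guaranteed mass c λ(Q), Q being the small-mass cube
  -- obtained next.
  have hε : c / 4 / K ≠ 0 :=
    (ENNReal.div_pos (ENNReal.div_pos hc (by simp)).ne' hK').ne'
  obtain ⟨i, hgi, z, hz, hzl, hsmall⟩ := hx.exists_small_mass hd ht htd hε
  have hzx : dyadicCell i z ⊆ dyadicCell g x := isDyadicUnion_dyadicCell hgi x z hz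
  obtain ⟨U, hUz, hUo, hU⟩ := hlow i z
  set v : ℝ≥0∞ := (2⁻¹ ^ i) ^ d with hv
  have hv0 : v ≠ 0 := pow_ne_zero _ (inv_two_pow_ne_zero i)
  have hv1 : v ≠ ∞ := ENNReal.pow_ne_top (inv_two_pow_ne_top i)
  have hδ0 := dyadicDiam_rpow_ne_zero hd t i
  have hδ1 := dyadicDiam_rpow_ne_top (d := d) ht i
  -- Chosen so that K λ ≤ L|·|^t on all cubes at least as fine as Q.
  set L : ℝ≥0∞ := K * (v / dyadicDiam d i ^ t) with hL
  have hL0 : L ≠ 0 := mul_ne_zero hK (ENNReal.div_pos hv0 hδ1).ne'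
  have hL1 : L ≠ ∞ := ENNReal.mul_ne_top hK' (ENNReal.div_ne_top hv1 hδ0)
  have hlim : Tendsto (fun J => L⁻¹ * dyadicDiam d J ^ (s - t) * M) atTop (𝓝 0) := by
    have := ENNReal.Tendsto.mul_const (b := M) (ENNReal.Tendsto.const_mul (a := L⁻¹)
      (tendsto_dyadicDiam_rpow (d := d) (sub_pos.2 hts)) (Or.inr (ENNReal.inv_ne_top.2 hL0)))
      (Or.inr hM)
    rwa [mul_zero, zero_mul] at this
  have hcv : 0 < c / 4 * v :=
    ENNReal.mul_pos (ENNReal.div_pos hc (by simp)).ne' hv0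
  -- The energy bound M is uniform in n, so J can be fixed before n; only the finitely many
  -- generations up to J then require n to be large.
  obtain ⟨J, hJ⟩ := (hlim.eventually_lt_const hcv).exists
  obtain ⟨n, hnU, hnup, hnN⟩ := (hU.and (((eventually_all_finite (Set.finite_Iic J)).2
    fun j _ => hup j).and (eventually_ge_atTop N))).exists
  have hheavy := measure_inter_heavySet_le_energy hd (μ := μ n) ht hts hzl hL0 hL1 (J := J)
    fun j hij hjJ y => by
      refine (hnup j hjJ y).trans ?_
      rw [hL, mul_assoc]
      refine mul_le_mul' le_rfl ?_
      rw [ENNReal.mul_comm_div, ← mul_div_assoc,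
        ENNReal.le_div_iff_mul_le (Or.inl hδ0) (Or.inl hδ1)]
      exact inv_two_pow_mul_dyadicDiam_rpow_le hij.le ht htd.le
  have hlt : μ n (dyadicCell i z ∩ heavySet ν t) < μ n U := by
    have h1 : L * ν (dyadicCell i z) ≤ c / 4 * v := by
      calc L * ν (dyadicCell i z) ≤ L * (c / 4 / K * dyadicDiam d i ^ t) := by gcongr
        _ = (c / 4 / K * K) * (v / dyadicDiam d i ^ t * dyadicDiam d i ^ t) := by rw [hL]; ring
        _ = c / 4 * v := by
          rw [ENNReal.div_mul_cancel hK hK', ENNReal.div_mul_cancel hδ0 hδ1]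
    have h2 : L⁻¹ * dyadicDiam d J ^ (s - t) * rieszEnergy s (μ n) < c / 4 * v :=
      (mul_le_mul' le_rfl (henergy n)).trans_lt hJ
    calc _ ≤ _ := hheavy
      _ < c / 4 * v + c / 4 * v := ENNReal.add_lt_add_of_le_of_lt
          (ENNReal.mul_ne_top (ENNReal.div_ne_top hc' (by simp)) hv1 |> ne_top_of_le_ne_top <| h1)
          h1 h2
      _ ≤ c / 2 * v + c / 2 * v := by gcongr <;> norm_num
      _ = c * v := by rw [← add_mul, ENNReal.add_halves]
      _ ≤ _ := hnU
  obtain ⟨y, ⟨hyU, hyE⟩, hyH⟩ : ∃ y ∈ U ∩ E n, y ∉ heavySet ν t := by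
    by_contra! hcon
    have hsub : U ⊆ (dyadicCell i z ∩ heavySet ν t) ∪ (E n)ᶜ := by
      intro y hy
      by_cases hyE : y ∈ E n
      · exact Or.inl ⟨hUz hy, hcon y ⟨hy, hyE⟩⟩
      · exact Or.inr hyE
    have := (measure_mono hsub).trans (measure_union_le (μ := μ n) _ _)
    rw [hμE, add_zero] at this
    exact absurd hlt (not_lt.2 this)
  obtain ⟨r, hr, hball⟩ := Metric.isOpen_iff.1 (hUo.inter (hE n)) y ⟨hyU, hyE⟩
  obtain ⟨m, hm⟩ := exists_dyadicCell_subset_ball d (half_pos hr)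
  -- All cubes around y are light, so the generation is free: m makes the cube fit in the ball, and
  -- g + 1 makes it strictly finer.
  refine ⟨n, hnN, g + 1 + m, by omega, y, isLight_of_notMem_heavySet hyH _, ?_⟩
  have hsub : closure (dyadicCell (g + 1 + m) y) ⊆ Metric.ball y r := by
    refine (closure_mono (hm (g + 1) y)).trans
      (Metric.closure_ball_subset_closedBall.trans (Metric.closedBall_subset_ball ?_))
    have : (2⁻¹ : ℝ) ^ (g + 1) ≤ 1 := pow_le_one₀ (by norm_num) (by norm_num)
    nlinarith
  exact fun w hw => ⟨hzx (hUz (hball (hsub hw)).1), (hball (hsub hw)).2⟩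

theorem dyadicDiam_rpow_le_dyadicContent (hd : 0 < d) {s t : ℝ} (ht : 0 ≤ t) (hts : t < s)
    (htd : t < d) {E : ℕ → Set (Torus d)} (hE : ∀ n, IsOpen (E n))
    {μ : ℕ → Measure (Torus d)} (hμE : ∀ n, μ n (E n)ᶜ = 0)
    {c K M : ℝ≥0∞} (hc : c ≠ 0) (hc' : c ≠ ∞) (hK : K ≠ 0) (hK' : K ≠ ∞) (hM : M ≠ ∞)
    (hup : ∀ j, ∀ᶠ n in atTop, ∀ y, μ n (dyadicCell j y) ≤ K * (2⁻¹ ^ j) ^ d)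
    (hlow : ∀ (j : ℕ) (x : Torus d), ∃ U ⊆ dyadicCell j x, IsOpen U ∧
      ∀ᶠ n in atTop, c * (2⁻¹ ^ j) ^ d ≤ μ n U)
    (henergy : ∀ n, rieszEnergy s (μ n) ≤ M) (g : ℕ) (k : Fin d → ℤ) :
    dyadicDiam d g ^ t ≤ dyadicContent t (limsup E atTop ∩ dyadicCube g k) := by
  refine le_iInf₂ fun 𝒟 h𝒟 => ?_
  by_contra! hlt
  choose p hp using fun q : ℕ × (Fin d → ℤ) => dyadicCube_nonempty q.1 q.2
  let ν : Measure (Torus d) :=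
    Measure.sum fun q : 𝒟 => (dyadicDiam d q.1.1 ^ t) • Measure.dirac (p q.1)
  have huniv : ν Set.univ < dyadicDiam d g ^ t := by
    rw [Measure.sum_apply _ MeasurableSet.univ]
    simpa using hlt
  have : IsFiniteMeasure ν := ⟨huniv.trans_le le_top⟩
  obtain ⟨x₀, hx₀⟩ := dyadicCube_nonempty g k
  have hlight : IsLight ν t g x₀ := fun i hi =>
    (measure_mono (Set.subset_univ _)).trans_lt
      (huniv.trans_le (ENNReal.rpow_le_rpow (antitone_dyadicDiam hi) ht))
  have step : ∀ (N : ℕ) (a : {a : ℕ × Torus d // IsLight ν t a.1 a.2}),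
      ∃ b : {a : ℕ × Torus d // IsLight ν t a.1 a.2}, a.1.1 < b.1.1 ∧ ∃ n ≥ N,
        closure (dyadicCell b.1.1 b.1.2) ⊆ dyadicCell a.1.1 a.1.2 ∩ E n := by
    intro N a
    obtain ⟨n, hn, j, hj, y, hy, hsub⟩ := a.2.exists_subcube hd ht hts htd hE hμE hc hc' hK hK' hM
      hup hlow henergy N
    exact ⟨⟨(j, y), hy⟩, hj, n, hn, hsub⟩
  choose next hnext hsub using step
  let f : ℕ → {a : ℕ × Torus d // IsLight ν t a.1 a.2} :=
    fun m => Nat.rec ⟨(g, x₀), hlight⟩ next m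
  have hmono : StrictMono fun m => (f m).1.1 := strictMono_nat_of_lt_succ fun m => hnext m (f m)
  have hsub' : ∀ m, ∃ n ≥ m, closure (dyadicCell (f (m + 1)).1.1 (f (m + 1)).1.2) ⊆
      dyadicCell (f m).1.1 (f m).1.2 ∩ E n := fun m => hsub m (f m)
  obtain ⟨x, hx⟩ := IsCompact.nonempty_iInter_of_sequence_nonempty_isCompact_isClosed
    (fun m => closure (dyadicCell (f m).1.1 (f m).1.2))
    (fun m => by
      obtain ⟨n, -, h⟩ := hsub' m
      exact (h.trans Set.inter_subset_left).trans subset_closure)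
    (fun m => ⟨_, subset_closure (mem_dyadicCell_self _ _)⟩)
    isClosed_closure.isCompact (fun m => isClosed_closure)
  have hxm : ∀ m, ∃ n ≥ m, x ∈ dyadicCell (f m).1.1 (f m).1.2 ∩ E n := by
    intro m
    obtain ⟨n, hn, h⟩ := hsub' m
    exact ⟨n, hn, h (Set.mem_iInter.1 hx (m + 1))⟩
  have hxlim : x ∈ limsup E atTop := by
    rw [mem_limsup_iff_frequently_mem]
    refine frequently_atTop.2 fun m => ?_
    obtain ⟨n, hn, h⟩ := hxm m
    exact ⟨n, hn, h.2⟩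
  -- Generations increase strictly, so the i-th cube has generation at least i, and its lightness
  -- controls all cubes around x up to generation i.
  have hxlight : ∀ i, IsLight ν t i x := by
    intro i j hj
    obtain ⟨n, -, h⟩ := hxm i
    exact (f i).2.congr h.1 j (hj.trans (hmono.id_le i))
  have hxD : x ∈ dyadicCube g k := by
    rw [dyadicCube_eq_dyadicCell hx₀]
    obtain ⟨n, -, h⟩ := hxm 0
    exact h.1
  obtain ⟨q, hq, hxq⟩ := Set.mem_iUnion₂.1 (h𝒟 ⟨hxlim, hxD⟩)
  refine absurd (hxlight q.1 q.1 le_rfl) (not_lt.2 ?_)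
  rw [← dyadicCube_eq_dyadicCell hxq]
  have hmem := hp q
  calc dyadicDiam d q.1 ^ t
      = ((dyadicDiam d q.1 ^ t) • Measure.dirac (p q)) (dyadicCube q.1 q.2) := by
        rw [Measure.smul_apply, Measure.dirac_apply_of_mem hmem, smul_eq_mul, mul_one]
    _ ≤ ν (dyadicCube q.1 q.2) :=
        Measure.le_sum (fun q : 𝒟 => (dyadicDiam d q.1.1 ^ t) • Measure.dirac (p q.1)) ⟨q, hq⟩ _

/-! ### Dyadic content, Hausdorff measure and dimension. -/

lemma dyadicContent_le_tsum (t : ℝ) {A : Set (Torus d)} (𝒟 : Set (ℕ × (Fin d → ℤ)))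
    (h : A ⊆ ⋃ p ∈ 𝒟, dyadicCube p.1 p.2) :
    dyadicContent t A ≤ ∑' p : 𝒟, dyadicDiam d p.1.1 ^ t :=
  iInf₂_le 𝒟 h

lemma dyadicContent_mono (t : ℝ) {A B : Set (Torus d)} (h : A ⊆ B) :
    dyadicContent t A ≤ dyadicContent t B :=
  le_iInf₂ fun 𝒟 h𝒟 => dyadicContent_le_tsum t 𝒟 (h.trans h𝒟)

lemma dyadicContent_iUnion_le (t : ℝ) (A : ℕ → Set (Torus d)) :
    dyadicContent t (⋃ n, A n) ≤ ∑' n, dyadicContent t (A n) := by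
  refine ENNReal.le_of_forall_pos_le_add fun ε hε hfin => ?_
  obtain ⟨ε', hε', hsum⟩ := ENNReal.exists_pos_sum_of_countable
    (ENNReal.coe_pos.2 hε).ne' ℕ
  have hex : ∀ n, ∃ 𝒟 : Set (ℕ × (Fin d → ℤ)), A n ⊆ ⋃ p ∈ 𝒟, dyadicCube p.1 p.2 ∧
      ∑' p : 𝒟, dyadicDiam d p.1.1 ^ t ≤ dyadicContent t (A n) + ε' n := by
    intro n
    have hlt : dyadicContent t (A n) < dyadicContent t (A n) + ε' n :=
      ENNReal.lt_add_right (ne_top_of_le_ne_top hfin.ne (ENNReal.le_tsum n))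
        (ENNReal.coe_pos.2 (hε' n)).ne'
    obtain ⟨𝒟, h⟩ := iInf_lt_iff.1 hlt
    obtain ⟨h𝒟, h⟩ := iInf_lt_iff.1 h
    exact ⟨𝒟, h𝒟, h.le⟩
  choose 𝒟 h𝒟 hle using hex
  calc dyadicContent t (⋃ n, A n) ≤ ∑' p : (⋃ n, 𝒟 n : Set (ℕ × (Fin d → ℤ))),
        dyadicDiam d p.1.1 ^ t := by
        refine dyadicContent_le_tsum t _ (Set.iUnion_subset fun n => (h𝒟 n).trans ?_)
        exact Set.biUnion_subset_biUnion_left (Set.subset_iUnion 𝒟 n)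
    _ ≤ ∑' n, ∑' p : 𝒟 n, dyadicDiam d p.1.1 ^ t :=
        ENNReal.tsum_iUnion_le_tsum (fun p : ℕ × (Fin d → ℤ) => dyadicDiam d p.1 ^ t) 𝒟
    _ ≤ ∑' n, (dyadicContent t (A n) + ε' n) := ENNReal.tsum_le_tsum hle
    _ = ∑' n, dyadicContent t (A n) + ∑' n, (ε' n : ℝ≥0∞) := ENNReal.tsum_add
    _ ≤ _ := by gcongr

/-- A set of diameter less than `2⁻ʲ` is covered by `3ᵈ` dyadic cubes of generation `j`. -/
lemma dyadicContent_le_of_ediam_lt (t : ℝ) {U : Set (Torus d)} {j : ℕ}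
    (hU : Metric.ediam U < 2⁻¹ ^ j) : dyadicContent t U ≤ 3 ^ d * dyadicDiam d j ^ t := by
  classical
  rcases U.eq_empty_or_nonempty with rfl | ⟨y, hy⟩
  · refine (dyadicContent_le_tsum t ∅ (Set.empty_subset _)).trans ?_
    simp
  let P : Finset (Fin d → ℤ) := Fintype.piFinset fun i =>
    Finset.Icc (dyadicIndex j y i - 1) (dyadicIndex j y i + 1)
  let 𝒟 : Finset (ℕ × (Fin d → ℤ)) := P.map ⟨fun k => (j, k), Prod.mk_right_injective j⟩
  have hcov : U ⊆ ⋃ p ∈ (𝒟 : Set (ℕ × (Fin d → ℤ))), dyadicCube p.1 p.2 := by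
    intro z hz
    have h2 : (0 : ℝ) < 2 ^ j := by positivity
    have hzy : dist z y < 2⁻¹ ^ j := by
      have h := (Metric.edist_le_ediam_of_mem hz hy).trans_lt hU
      rw [edist_dist, ENNReal.ofReal_lt_iff_lt_toReal dist_nonneg (inv_two_pow_ne_top j)] at h
      simpa using h
    choose r hr hr' using fun i => UnitAddCircle.exists_lift_norm (z i - y i)
    have hrlt : ∀ i, |2 ^ j * r i| < 1 := by
      intro i
      have h := (dist_apply_le_dist z y i).trans_lt hzy
      rw [dist_eq_norm, ← hr', inv_pow, ← one_div, lt_div_iff₀ h2] at h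
      rwa [abs_mul, abs_of_pos h2, mul_comm]
    refine Set.mem_iUnion₂.2 ⟨(j, fun i => ⌊2 ^ j * (circleRep (y i) + r i)⌋), ?_, fun i => ?_⟩
    · refine Finset.mem_coe.2 (Finset.mem_map.2 ⟨_, Fintype.mem_piFinset.2 fun i => ?_, rfl⟩)
      have h := abs_lt.1 (hrlt i)
      have h1 := Int.floor_le (2 ^ j * circleRep (y i))
      have h3 := Int.lt_floor_add_one (2 ^ j * circleRep (y i))
      rw [Finset.mem_Icc]
      constructor
      · refine Int.le_floor.2 ?_
        rw [dyadicIndex]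
        push_cast
        linarith
      · refine Int.lt_add_one_iff.1 (Int.floor_lt.2 ?_)
        rw [dyadicIndex]
        push_cast
        linarith
    · refine ⟨circleRep (y i) + r i, ?_, ?_⟩
      · have h := Int.floor_eq_iff.1 (rfl : ⌊2 ^ j * (circleRep (y i) + r i)⌋ = _)
        rw [Set.mem_Ico, inv_pow, ← div_eq_mul_inv, ← div_eq_mul_inv, div_le_iff₀ h2,
          lt_div_iff₀ h2, mul_comm _ (2 ^ j : ℝ)]
        exact h
      · simp only [AddCircle.coe_add, hr, coe_circleRep]
        abel
  refine (dyadicContent_le_tsum t _ hcov).trans (le_of_eq ?_)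
  rw [Finset.tsum_subtype' 𝒟 fun p : ℕ × (Fin d → ℤ) => dyadicDiam d p.1 ^ t, Finset.sum_map]
  have hcard : P.card = 3 ^ d := by
    rw [Fintype.card_piFinset]
    have : ∀ a : ℤ, (a + 1 + 1 - (a - 1)).toNat = 3 := fun a => by
      rw [show a + 1 + 1 - (a - 1) = 3 by ring]; rfl
    simp [Int.card_Icc, this]
  simp [hcard]

/-- The generation j is taken with 2^(-j-1) ≤ diam < 2^(-j), which costs the factor 2^t. For
diameter zero every j is allowed and t > 0 sends the bound to 0. -/
lemma dyadicContent_le_ediam_rpow {t : ℝ} (ht : 0 < t) {U : Set (Torus d)}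
    (hU : Metric.ediam U < 1) :
    dyadicContent t U ≤ 3 ^ d * dyadicDiam d 0 ^ t * 2 ^ t * Metric.ediam U ^ t := by
  rcases eq_or_ne (Metric.ediam U) 0 with h0 | h0
  · have hlim : Tendsto (fun j => 3 ^ d * dyadicDiam d j ^ t) atTop (𝓝 0) := by
      have := ENNReal.Tendsto.const_mul (a := 3 ^ d) (tendsto_dyadicDiam_rpow (d := d) ht)
        (Or.inr (ENNReal.pow_ne_top (by simp)))
      rwa [mul_zero] at this
    refine (ge_of_tendsto' hlim fun j => dyadicContent_le_of_ediam_lt t ?_).trans zero_le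
    rw [h0]
    exact pos_iff_ne_zero.2 (inv_two_pow_ne_zero j)
  classical
  have hex : ∃ n : ℕ, (2⁻¹ : ℝ≥0∞) ^ n ≤ Metric.ediam U := by
    have h : Tendsto (fun n : ℕ => (2⁻¹ : ℝ≥0∞) ^ n) atTop (𝓝 0) :=
      ENNReal.tendsto_pow_atTop_nhds_zero_of_lt_one (by simp)
    obtain ⟨n, hn⟩ := (h.eventually_lt_const (pos_iff_ne_zero.2 h0)).exists
    exact ⟨n, hn.le⟩
  obtain ⟨j, hj⟩ : ∃ j, Nat.find hex = j + 1 := by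
    refine Nat.exists_eq_succ_of_ne_zero fun h => ?_
    have := Nat.find_spec hex
    rw [h, pow_zero] at this
    exact absurd hU (not_lt.2 this)
  have h1 : (2⁻¹ : ℝ≥0∞) ^ (j + 1) ≤ Metric.ediam U := hj ▸ Nat.find_spec hex
  have h2 : Metric.ediam U < (2⁻¹ : ℝ≥0∞) ^ j := not_le.1 (Nat.find_min hex (by omega))
  calc dyadicContent t U ≤ 3 ^ d * dyadicDiam d j ^ t := dyadicContent_le_of_ediam_lt t h2
    _ = 3 ^ d * dyadicDiam d 0 ^ t * (2 * 2⁻¹ ^ (j + 1)) ^ t := by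
        rw [dyadicDiam_rpow t ht.le, pow_succ', ← mul_assoc 2,
          ENNReal.mul_inv_cancel (by simp) (by simp), one_mul, mul_assoc]
    _ = 3 ^ d * dyadicDiam d 0 ^ t * 2 ^ t * (2⁻¹ ^ (j + 1)) ^ t := by
        rw [ENNReal.mul_rpow_of_nonneg _ _ ht.le, mul_assoc _ (2 ^ t)]
    _ ≤ _ := mul_le_mul' le_rfl (ENNReal.rpow_le_rpow h1 ht.le)

lemma dyadicContent_le_hausdorffMeasure {t : ℝ} (ht : 0 < t) (A : Set (Torus d)) :
    dyadicContent t A / (3 ^ d * dyadicDiam d 0 ^ t * 2 ^ t) ≤ μH[t] A := by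
  rw [Measure.hausdorffMeasure_apply]
  -- One fixed scale below 1 suffices, since the content does not restrict cube sizes.
  refine le_trans ?_ (le_iSup₂ (2⁻¹ : ℝ≥0∞) (by simp))
  refine le_iInf fun V => le_iInf fun hV => le_iInf fun hdiam => ?_
  refine ENNReal.div_le_of_le_mul' ?_
  rw [← ENNReal.tsum_mul_left]
  refine (dyadicContent_mono t hV).trans ((dyadicContent_iUnion_le t V).trans ?_)
  refine ENNReal.tsum_le_tsum fun n => ?_
  have hn : Metric.ediam (V n) < 1 := (hdiam n).trans_lt (by simp)
  refine (dyadicContent_le_ediam_rpow ht hn).trans ?_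
  gcongr
  rcases (V n).eq_empty_or_nonempty with h | h
  · simp [h, ht]
  · simp [h]

lemma isGδ_limsup_of_isOpen {X : Type*} [TopologicalSpace X] {E : ℕ → Set X}
    (hE : ∀ n, IsOpen (E n)) : IsGδ (limsup E atTop) := by
  rw [limsup_eq_iInf_iSup_of_nat]
  simp only [Set.iInf_eq_iInter, Set.iSup_eq_iUnion]
  exact IsGδ.iInter fun n => (isOpen_biUnion fun i _ => hE i).isGδ

lemma ofReal_le_dimH_of_mem_largeIntersectionClass (hd : 0 < d) {s : ℝ} {A : Set (Torus d)}
    (hA : A ∈ largeIntersectionClass d s) : ENNReal.ofReal s ≤ dimH A := by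
  refine ENNReal.le_of_forall_nnreal_lt fun r hr => ?_
  rcases eq_or_ne r 0 with rfl | hr0
  · simp
  have hrs : (r : ℝ) < s := by
    rw [ENNReal.lt_ofReal_iff_toReal_lt ENNReal.coe_ne_top] at hr
    simpa using hr
  have ht : 0 < (r : ℝ) := NNReal.coe_pos.2 (pos_iff_ne_zero.2 hr0)
  refine le_dimH_of_hausdorffMeasure_ne_zero fun h0 => ?_
  have h1 := dyadicContent_le_hausdorffMeasure ht A
  have hc : dyadicContent r A ≠ 0 := by
    have := (hA.2 r ht.le hrs 0 0).trans (dyadicContent_mono _ Set.inter_subset_left)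
    exact ((pos_iff_ne_zero.2 (dyadicDiam_rpow_ne_zero hd _ 0)).trans_le this).ne'
  rw [h0, nonpos_iff_eq_zero, ENNReal.div_eq_zero_iff] at h1
  refine h1.elim hc (ENNReal.mul_ne_top (ENNReal.mul_ne_top (ENNReal.pow_ne_top (by simp))
    (dyadicDiam_rpow_ne_top ht.le 0)) (ENNReal.rpow_ne_top_of_nonneg ht.le (by simp)))

end

theorem lemma2 (d : ℕ) (s : ℝ) (hs : 0 < s)
    (E : ℕ → Set (Torus d)) (hE : ∀ n, IsOpen (E n))
    (μ : ℕ → Measure (Torus d)) (hμE : ∀ n, μ n (E n)ᶜ = 0)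
    (hμ : ∀ n, μ n ≪ torusLebesgue d)
    (C : ℝ)
    (hdensity : ∀ (x : Torus d) (r : ℝ), 0 < r →
      ENNReal.ofReal C⁻¹ ≤
        liminf (fun n => μ n (Metric.ball x r) / torusLebesgue d (Metric.ball x r)) atTop ∧
      limsup (fun n => μ n (Metric.ball x r) / torusLebesgue d (Metric.ball x r)) atTop ≤
        ENNReal.ofReal C)
    (henergy : ∀ n, rieszEnergy s (μ n) < ENNReal.ofReal C) :
    limsup E atTop ∈ largeIntersectionClass d s ∧
      ENNReal.ofReal s ≤ dimH (limsup E atTop) := by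
  have hC : 0 < C := ENNReal.ofReal_pos.1 ((zero_le).trans_lt (henergy 0))
  obtain ⟨K, hK, hK', hup⟩ := exists_eventually_measure_dyadicCell_le hC
    fun x r hr => (hdensity x r hr).2
  obtain ⟨c, hc, hc', hlow⟩ := exists_eventually_le_measure hC fun x r hr => (hdensity x r hr).1
  have hen := fun n => (henergy n).le
  have hsd : s ≤ d := le_dimension_of_rieszEnergy_le hs hc ENNReal.ofReal_ne_top hlow hen
  -- Positivity of d follows from 0 < s ≤ d.
  have hd : 0 < d := by exact_mod_cast hs.trans_le hsd
  have hmem : limsup E atTop ∈ largeIntersectionClass d s :=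
    ⟨isGδ_limsup_of_isOpen hE, fun t ht hts g k =>
      dyadicDiam_rpow_le_dyadicContent hd ht hts (hts.trans_le hsd) hE hμE hc hc' hK hK'
        ENNReal.ofReal_ne_top hup hlow hen g k⟩
  exact ⟨hmem, ofReal_le_dimH_of_mem_largeIntersectionClass hd hmem⟩
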